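/- Let $\Psi=\{\psi_1,\dots,\psi_M\}$ be a finite family of real maps, and let $I\subseteq\mathbb R$ be a closed (possibly unbounded) interval such that, for every $i$, $\psi_i$ is $C^2$ on $I$, $\psi_i(I)\subseteq I$, and $0<\sigma\le|\psi_i'(x)|\le\delta<1$ for all $x\in I$, where the constants $\sigma,\delta$ do not depend on $i$ and $x$. Assume also that at least two different points of $I$ are fixed points of maps of $\Psi$. (Such a $\Psi$ is called a finite, non-singular, hyperbolic $C^2$ iterated function system.) Let $K_\Psi$ be its attractor, that is, the unique nonempty compact set $K\subseteq I$ with $K=\overline{\bigcup_{i}\psi_i(K)}$. For $0<\alpha<1$ and a nonempty compact set $K\subset\mathbb R$, let $\Phi=\Phi(\alpha,K)$ be the second-generation iterated function system of all the maps $\phi_\beta(x)=\alpha x+(1-\alpha)\beta$, $\beta\in K$, and let $K_\Phi$ be its attractor, that is, the unique nonempty compact set with $K_\Phi=\overline{\bigcup_{\beta\in K}\phi_\beta(K_\Phi)}$. 1. For every $\Psi$ as above and every $0<\alpha<1$, the attractor $K_\Phi$ of $\Phi(\alpha,K_\Psi)$ is a finite union of closed bounded intervals of positive length. 2. The same is true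 of the attractor $K_\Phi$ of $\Phi(\alpha,K)$, for every $0<\alpha<1$ and every Cantor set $K\subset\mathbb R$ (a nonempty compact totally disconnected set without isolated points) that admits a construction of uniformly lower bounded dissections. This means that there are a family of intervals $I_w=[a_w,b_w]$, indexed by the finite words $w$ in the letters $0,1$ (including the empty word), and a constant $r>0$ such that, for every word $w$, $$a_{w0}=a_w<b_{w0}<a_{w1}<b_{w1}=b_w,\qquad \frac{b_{wj}-a_{wj}}{b_w-a_w}\ge r\quad(j=0,1),$$ and $K=\bigcap_{n\ge0}\bigcup_{|w|=n}I_w$. -/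

import Mathlib

open Set

namespace SecondGenIFS

/-- The operator `A ↦ closure (⋃ ψ ∈ Ψ, ψ(A))` of a set `Ψ` of maps of the line. -/
def hutchinson (Ψ : Set (ℝ → ℝ)) (A : Set ℝ) : Set ℝ :=
  closure (⋃ f ∈ Ψ, f '' A)

/-- `K` is a nonempty compact subset of `X` that is a fixed point of the operator of `Ψ`. -/
structure IsInvariantCompact (Ψ : Set (ℝ → ℝ)) (X K : Set ℝ) : Prop where
  nonempty : K.Nonempty
  isCompact : IsCompact K
  subset : K ⊆ X
  fixed : hutchinson Ψ K = K

/-- `K` is the attractor of the iterated function system `Ψ` acting on `X`: the unique nonempty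
compact subset of `X` that is a fixed point of the operator of `Ψ`. -/
def IsAttractor (Ψ : Set (ℝ → ℝ)) (X K : Set ℝ) : Prop :=
  IsInvariantCompact Ψ X K ∧ ∀ K' : Set ℝ, IsInvariantCompact Ψ X K' → K' = K

/-- A finite, non-singular, hyperbolic `C²` iterated function system on the closed (possibly
unbounded) interval `I`. Only the restrictions of the maps to `I` play a role; at an endpoint of
`I` the derivative is the one-sided one. -/
structure IsNonsingularHyperbolic {M : ℕ} (ψ : Fin M → ℝ → ℝ) (I : Set ℝ) : Prop where
  ordConnected : I.OrdConnected
  isClosed : IsClosed I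
  contDiffOn : ∀ i, ContDiffOn ℝ 2 (ψ i) I
  deriv_bounds : ∃ σ δ : ℝ, 0 < σ ∧ δ < 1 ∧
    ∀ i, ∀ x ∈ I, σ ≤ |derivWithin (ψ i) I x| ∧ |derivWithin (ψ i) I x| ≤ δ
  mapsTo : ∀ i, MapsTo (ψ i) I I
  two_fixedPoints : ∃ i j, ∃ x ∈ I, ∃ y ∈ I, ψ i x = x ∧ ψ j y = y ∧ x ≠ y

/-- The homogeneous affine map `x ↦ α x + (1 - α) β`, with contraction ratio `α` and fixed
point `β`. -/
def affineMap (α β : ℝ) : ℝ → ℝ := fun x => α * x + (1 - α) * β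

/-- The second generation system: all the maps `affineMap α β` with `β ∈ K`. -/
def secondGeneration (α : ℝ) (K : Set ℝ) : Set (ℝ → ℝ) := affineMap α '' K

/-- A Cantor set: a nonempty compact totally disconnected subset of the line without isolated
points. -/
structure IsCantorSet (K : Set ℝ) : Prop where
  nonempty : K.Nonempty
  isCompact : IsCompact K
  isTotallyDisconnected : IsTotallyDisconnected K
  preperfect : Preperfect K

/-- A dissection construction: to every finite binary word `w` (`false` is the letter `0`, `true`
is the letter `1`) an interval `[a w, b w]` is assigned, in such a way that the intervals of the
words `w0` and `w1` are obtained by removing from `[a w, b w]` a nonempty open interval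
`(c, d)` with `a w < c < d < b w`. -/
structure Construction where
  a : List Bool → ℝ
  b : List Bool → ℝ
  left_eq : ∀ w, a (w ++ [false]) = a w
  right_eq : ∀ w, b (w ++ [true]) = b w
  lt_left : ∀ w, a w < b (w ++ [false])
  lt_gap : ∀ w, b (w ++ [false]) < a (w ++ [true])
  lt_right : ∀ w, a (w ++ [true]) < b w

namespace Construction

/-- The interval of the word `w`. -/
def interval (C : Construction) (w : List Bool) : Set ℝ := Icc (C.a w) (C.b w)

/-- The ratio of dissection associated with the word `wj`. -/
noncomputable def ratio (C : Construction) (w : List Bool) (j : Bool) : ℝ :=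
  (C.b (w ++ [j]) - C.a (w ++ [j])) / (C.b w - C.a w)

/-- The union of the intervals of the words of length `n`. -/
def level (C : Construction) (n : ℕ) : Set ℝ :=
  ⋃ w ∈ {w : List Bool | w.length = n}, C.interval w

/-- The set constructed by `C`. -/
def limitSet (C : Construction) : Set ℝ := ⋂ n : ℕ, C.level n

/-- Uniformly lower bounded dissections: all ratios are at least some positive constant. -/
def IsUlbd (C : Construction) : Prop := ∃ r : ℝ, 0 < r ∧ ∀ w j, r ≤ C.ratio w j

end Construction

/-- `K` is the set constructed by some construction of uniformly lower bounded dissections. -/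
def AdmitsUlbd (K : Set ℝ) : Prop := ∃ C : Construction, C.IsUlbd ∧ C.limitSet = K

/-- `S` is a finite union of closed bounded intervals, none of them reduced to a point. -/
def IsFiniteUnionOfClosedIntervals (S : Set ℝ) : Prop :=
  ∃ (n : ℕ) (c d : Fin n → ℝ), (∀ i, c i < d i) ∧ S = ⋃ i, Icc (c i) (d i)

end SecondGenIFS

/-! Unfolding the invariance $N$ times gives $K_\Phi=\alpha^N K_\Phi+\sum_{k<N}(1-\alpha)\alpha^k
K$, so it suffices that sums of many scaled pieces of $K$ fill intervals.

Suppose $K$ carries a tree of intervals whose child-to-parent ratios lie in $[r,1-r]$. Take $N$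
scaled tree intervals whose lengths agree up to the factor $r$, with $r(N-1)\ge1$. Their total
length is at least twice the longest one, so a point of their sum stays in the sum when the longest
is replaced by a suitable end child. Comparability survives and the total length decays
geometrically, hence the point is a sum of points of scaled copies of $K$ (`exists_refinement`,
`Icc_subset_sum`). Choosing tree intervals around the first $N$ digits of $x\in K_\Phi$, all of one
scale after weighting, puts $x$ in an interval of definite length inside $K_\Phi$; compactness
leaves finitely many components (`UniformDissection.exists_attractor`).

It remains to find the tree. A dissection with ratios at least $r$ is one. For a hyperbolic $C^2$
system the tree consists of the images of the hull of $K_\Psi$ under compositions of the maps,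
possibly overlapping. Its ratios are controlled by bounded distortion: $\log|\psi_i'|$ is Lipschitz
on the hull and the images shrink geometrically (`exists_wordMap_distortion`,
`exists_uniformDissection_of_isDistortionBounded`). -/

namespace SecondGenIFS

/-! ### Trees of intervals with uniformly bounded ratios -/

/-- A tree of intervals `[a w, b w]`, indexed by the words in the letters of `A`, with endpoints
in `K` and whose levels cover `K`. Each interval has a child at each of its two endpoints, and
the ratio between the length of a child and that of its parent lies in `[r, 1 - r]`. -/
structure UniformDissection {A : Type*} (a b : List A → ℝ) (r : ℝ) (K : Set ℝ) : Prop where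
  pos : 0 < r
  lt : ∀ w, a w < b w
  left_mem : ∀ w, a w ∈ K
  right_mem : ∀ w, b w ∈ K
  left_le : ∀ w j, a w ≤ a (w ++ [j])
  right_le : ∀ w j, b (w ++ [j]) ≤ b w
  le_ratio : ∀ w j, r * (b w - a w) ≤ b (w ++ [j]) - a (w ++ [j])
  ratio_le : ∀ w j, b (w ++ [j]) - a (w ++ [j]) ≤ (1 - r) * (b w - a w)
  exists_left : ∀ w, ∃ j, a (w ++ [j]) = a w
  exists_right : ∀ w, ∃ j, b (w ++ [j]) = b w
  cover : ∀ x ∈ K, ∀ n : ℕ, ∃ w, w.length = n ∧ x ∈ Icc (a w) (b w)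

namespace UniformDissection

variable {A : Type*} {a b : List A → ℝ} {r : ℝ} {K : Set ℝ}

lemma lt_one (h : UniformDissection a b r K) : r < 1 := by
  obtain ⟨j, -⟩ := h.exists_left []
  have h1 := h.le_ratio [] j
  have h2 := h.ratio_le [] j
  have h3 := h.lt []
  have h4 := h.pos
  by_contra! h5
  nlinarith

lemma length_le (h : UniformDissection a b r K) (w : List A) :
    b w - a w ≤ (1 - r) ^ w.length * (b [] - a []) := by
  induction w using List.reverseRecOn with
  | nil => simp
  | append_singleton w j ih =>
    have h1 := h.ratio_le w j
    have h2 := h.lt_one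
    rw [List.length_append, List.length_singleton, pow_succ]
    nlinarith [mul_le_mul_of_nonneg_left ih (sub_nonneg.2 h2.le)]

/-- Any interval of the tree is contained in one of prescribed size, up to the factor `r`. -/
lemma exists_scale (h : UniformDissection a b r K) {ε : ℝ} (hε : ε ≤ b [] - a [])
    (w : List A) (hw : b w - a w ≤ ε) :
    ∃ v, Icc (a w) (b w) ⊆ Icc (a v) (b v) ∧ r * ε ≤ b v - a v ∧ b v - a v ≤ ε := by
  -- Climb towards the root until the parent is longer than `ε`; the interval reached then has
  -- length at least `r * ε`.
  induction w using List.reverseRecOn with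
  | nil =>
    refine ⟨[], Subset.rfl, ?_, hw⟩
    nlinarith [h.lt_one, h.pos, h.lt []]
  | append_singleton w j ih =>
    by_cases hlt : b w - a w ≤ ε
    · obtain ⟨v, hv, hv'⟩ := ih hlt
      exact ⟨v, (Icc_subset_Icc (h.left_le w j) (h.right_le w j)).trans hv, hv'⟩
    · refine ⟨w ++ [j], Subset.rfl, ?_, hw⟩
      nlinarith [h.le_ratio w j, h.pos]

lemma exists_mem_scale (h : UniformDissection a b r K) {ε : ℝ} (hε0 : 0 < ε)
    (hε : ε ≤ b [] - a []) {x : ℝ} (hx : x ∈ K) :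
    ∃ v, x ∈ Icc (a v) (b v) ∧ r * ε ≤ b v - a v ∧ b v - a v ≤ ε := by
  have hL := sub_pos.2 (h.lt [])
  obtain ⟨n, hn⟩ := exists_pow_lt_of_lt_one (div_pos hε0 hL)
    (show 1 - r < 1 by linarith [h.pos])
  obtain ⟨w, rfl, hxw⟩ := h.cover x hx n
  obtain ⟨v, hv, hv'⟩ := h.exists_scale hε w
    ((h.length_le w).trans ((lt_div_iff₀ hL).1 hn).le)
  exact ⟨v, hv hxw, hv'⟩

/-- Replacing the longest term of a sum of intervals of comparable lengths by one of its
children, so that the sum still contains a given point. -/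
lemma exists_refinement (h : UniformDissection a b r K) {ι : Type*} [DecidableEq ι]
    (s : Finset ι) (hs : s.Nonempty)
    (hcard : 1 ≤ r * ((s.card : ℝ) - 1)) (c : ι → ℝ) (hc : ∀ k ∈ s, 0 < c k) (t : ℝ)
    (w : ι → List A)
    (hcomp : ∀ i ∈ s, ∀ k ∈ s, r * (c i * (b (w i) - a (w i))) ≤ c k * (b (w k) - a (w k)))
    (h1 : ∑ k ∈ s, c k * a (w k) ≤ t) (h2 : t ≤ ∑ k ∈ s, c k * b (w k)) :
    ∃ w' : ι → List A,
      (∀ i ∈ s, ∀ k ∈ s, r * (c i * (b (w' i) - a (w' i))) ≤ c k * (b (w' k) - a (w' k))) ∧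
      ∑ k ∈ s, c k * a (w' k) ≤ t ∧ t ≤ ∑ k ∈ s, c k * b (w' k) ∧
      ∑ k ∈ s, c k * (b (w' k) - a (w' k)) ≤
        (1 - r / s.card) * ∑ k ∈ s, c k * (b (w k) - a (w k)) := by
  have hr := h.pos
  have hr1 := h.lt_one
  obtain ⟨m, hm, hmax⟩ := s.exists_max_image (fun k => c k * (b (w k) - a (w k))) hs
  have hcm := hc m hm
  set l : ι → ℝ := fun k => c k * (b (w k) - a (w k)) with hl
  have hlpos : 0 < l m := mul_pos hcm (sub_pos.2 (h.lt _))
  have hN : (0 : ℝ) < s.card := by exact_mod_cast hs.card_pos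
  have hS1 : ∑ k ∈ s, l k ≤ s.card * l m := by
    simpa using Finset.sum_le_card_nsmul s l (l m) hmax
  -- Each of the other `s.card - 1` terms is at least `r * l m`, so by `hcard` together they are at
  -- least `l m`.
  have hS2 : 2 * l m ≤ ∑ k ∈ s, l k := by
    rw [← Finset.add_sum_erase s l hm]
    have h3 : ((s.erase m).card : ℝ) * (r * l m) ≤ ∑ k ∈ s.erase m, l k := by
      simpa using Finset.card_nsmul_le_sum (s.erase m) l (r * l m)
        (fun k hk => hcomp m hm k (Finset.mem_of_mem_erase hk))
    have h4 : ((s.erase m).card : ℝ) = s.card - 1 := by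
      rw [Finset.card_erase_of_mem hm, Nat.cast_sub hs.card_pos]; simp
    rw [h4] at h3
    nlinarith
  have hdiff : ∀ (f : List A → ℝ) (j : A),
      ∑ k ∈ s, c k * f (Function.update w m (w m ++ [j]) k) =
        ∑ k ∈ s, c k * f (w k) + c m * (f (w m ++ [j]) - f (w m)) := by
    intro f j
    rw [← sub_eq_iff_eq_add', ← Finset.sum_sub_distrib, Finset.sum_eq_single m]
    · simp [mul_sub]
    · intro k _ hk
      simp [hk]
    · exact fun hm' => (hm' hm).elim
  have hsub : ∑ k ∈ s, l k = ∑ k ∈ s, c k * b (w k) - ∑ k ∈ s, c k * a (w k) := by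
    rw [← Finset.sum_sub_distrib]; exact Finset.sum_congr rfl fun k _ => mul_sub ..
  -- Any child will do, provided `t` stays in the sum: all new lengths lie between `r * l m` and `l
  -- m`, and the total drops by at least `r * l m`, which is at least `r / s.card` of it.
  have key : ∀ j : A,
      ∑ k ∈ s, c k * a (Function.update w m (w m ++ [j]) k) ≤ t →
      t ≤ ∑ k ∈ s, c k * b (Function.update w m (w m ++ [j]) k) → ∃ w' : ι → List A,
      (∀ i ∈ s, ∀ k ∈ s, r * (c i * (b (w' i) - a (w' i))) ≤ c k * (b (w' k) - a (w' k))) ∧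
      ∑ k ∈ s, c k * a (w' k) ≤ t ∧ t ≤ ∑ k ∈ s, c k * b (w' k) ∧
      ∑ k ∈ s, c k * (b (w' k) - a (w' k)) ≤ (1 - r / s.card) * ∑ k ∈ s, l k := by
    intro j hj1 hj2
    refine ⟨Function.update w m (w m ++ [j]), ?_, hj1, hj2, ?_⟩
    · have hub : ∀ i ∈ s, c i * (b (Function.update w m (w m ++ [j]) i) -
          a (Function.update w m (w m ++ [j]) i)) ≤ l m := by
        intro i hi
        rcases eq_or_ne i m with rfl | hne
        · have := mul_le_mul_of_nonneg_left (h.ratio_le (w i) j) hcm.le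
          simp only [Function.update_self]
          nlinarith
        · simpa [hne] using hmax i hi
      have hlb : ∀ k ∈ s, r * l m ≤ c k * (b (Function.update w m (w m ++ [j]) k) -
          a (Function.update w m (w m ++ [j]) k)) := by
        intro k hk
        rcases eq_or_ne k m with rfl | hne
        · have := mul_le_mul_of_nonneg_left (h.le_ratio (w k) j) hcm.le
          simp only [Function.update_self]
          simp only [hl]
          linarith
        · simpa [hne] using hcomp m hm k hk
      intro i hi k hk
      exact (mul_le_mul_of_nonneg_left (hub i hi) hr.le).trans (hlb k hk)
    · rw [hdiff (fun v => b v - a v) j]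
      have h5 := mul_le_mul_of_nonneg_left (h.ratio_le (w m) j) hcm.le
      have h6 : r / s.card * ∑ k ∈ s, l k ≤ r * l m := by
        rw [div_mul_eq_mul_div, div_le_iff₀ hN]
        nlinarith
      simp only [hl] at h6 ⊢
      linarith
  -- A left child lowers the upper sum by at most `l m`. A right child raises the lower sum by at
  -- most `l m`, harmless in the other case since `hS2` puts `t` above the lower sum plus `l m`.
  by_cases hcase : t ≤ ∑ k ∈ s, c k * b (w k) - l m
  · obtain ⟨j, hj⟩ := h.exists_left (w m)
    refine key j ?_ ?_
    · rw [hdiff a, hj]; simpa using h1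
    · rw [hdiff b]
      have := mul_le_mul_of_nonneg_left (h.lt (w m ++ [j])).le hcm.le
      rw [hj] at this
      simp only [hl] at hcase
      linarith
  · obtain ⟨j, hj⟩ := h.exists_right (w m)
    refine key j ?_ ?_
    · rw [hdiff a]
      have := mul_le_mul_of_nonneg_left (h.lt (w m ++ [j])).le hcm.le
      rw [hj] at this
      have h7 : l m = c m * b (w m) - c m * a (w m) := mul_sub ..
      linarith
    · rw [hdiff b, hj]; simpa using h2

/-- If sufficiently many intervals of comparable lengths are chosen, then their sum is covered by
the sum of the corresponding multiples of `K`. -/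
lemma Icc_subset_sum (h : UniformDissection a b r K) (hK : IsCompact K) {ι : Type*}
    (s : Finset ι) (hs : s.Nonempty) (hcard : 1 ≤ r * ((s.card : ℝ) - 1))
    (c : ι → ℝ) (hc : ∀ k ∈ s, 0 < c k) (w : ι → List A)
    (hcomp : ∀ i ∈ s, ∀ k ∈ s, r * (c i * (b (w i) - a (w i))) ≤ c k * (b (w k) - a (w k)))
    {t : ℝ} (ht : t ∈ Icc (∑ k ∈ s, c k * a (w k)) (∑ k ∈ s, c k * b (w k))) :
    ∃ x : ι → ℝ, (∀ k, x k ∈ K) ∧ ∑ k ∈ s, c k * x k = t := by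
  classical
  set S := ∑ k ∈ s, c k * (b (w k) - a (w k)) with hS
  have hN : (1 : ℝ) ≤ s.card := by exact_mod_cast hs.card_pos
  have hρ : 0 < r / s.card := div_pos h.pos (by linarith)
  have hρ1 : r / s.card ≤ 1 := (div_le_one (by linarith)).2 (by linarith [h.lt_one])
  have step : ∀ n : ℕ, ∃ w' : ι → List A,
      (∀ i ∈ s, ∀ k ∈ s, r * (c i * (b (w' i) - a (w' i))) ≤ c k * (b (w' k) - a (w' k))) ∧
      ∑ k ∈ s, c k * a (w' k) ≤ t ∧ t ≤ ∑ k ∈ s, c k * b (w' k) ∧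
      ∑ k ∈ s, c k * (b (w' k) - a (w' k)) ≤ (1 - r / s.card) ^ n * S := by
    intro n
    induction n with
    | zero => exact ⟨w, hcomp, ht.1, ht.2, by simp [hS]⟩
    | succ n ih =>
      obtain ⟨v, hv, hv1, hv2, hv3⟩ := ih
      obtain ⟨v', h1, h2, h3, h4⟩ := h.exists_refinement s hs hcard c hc t v hv hv1 hv2
      refine ⟨v', h1, h2, h3, h4.trans ?_⟩
      rw [pow_succ', mul_assoc]
      exact mul_le_mul_of_nonneg_left hv3 (by linarith)
  have hcont : Continuous fun x : ι → ℝ => ∑ k ∈ s, c k * x k := by fun_prop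
  have hcl := ((isCompact_univ_pi fun _ : ι => hK).image hcont).isClosed
  -- Left endpoints lie in `K`, and their weighted sums approach `t` because the total length tends
  -- to zero.
  have hmem : t ∈ closure ((fun x : ι → ℝ => ∑ k ∈ s, c k * x k) '' Set.univ.pi fun _ => K) := by
    rw [Metric.mem_closure_iff]
    intro ε hε
    have hlim : Filter.Tendsto (fun n : ℕ => (1 - r / s.card) ^ n * S) Filter.atTop (nhds 0) := by
      simpa using (tendsto_pow_atTop_nhds_zero_of_lt_one (by linarith)
        (show 1 - r / s.card < 1 by linarith)).mul_const S
    obtain ⟨n, hn⟩ := (hlim.eventually_lt_const hε).exists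
    obtain ⟨v, -, hv1, hv2, hv3⟩ := step n
    refine ⟨_, ⟨fun k => a (v k), fun k _ => h.left_mem _, rfl⟩, ?_⟩
    rw [Real.dist_eq, abs_of_nonneg (sub_nonneg.2 hv1)]
    simp only [mul_sub, Finset.sum_sub_distrib] at hv3
    linarith
  rw [hcl.closure_eq] at hmem
  obtain ⟨x, hx, rfl⟩ := hmem
  exact ⟨x, fun k => hx k (mem_univ k), rfl⟩

end UniformDissection

/-! ### Finite unions of intervals -/

lemma isFiniteUnionOfClosedIntervals_of_finset {S : Set ℝ} (t : Finset (ℝ × ℝ))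
    (ht : ∀ p ∈ t, p.1 < p.2) (hS : S = ⋃ p ∈ t, Icc p.1 p.2) :
    IsFiniteUnionOfClosedIntervals S := by
  refine ⟨t.card, fun i => (t.equivFin.symm i).1.1, fun i => (t.equivFin.symm i).1.2,
    fun i => ht _ (t.equivFin.symm i).2, ?_⟩
  rw [hS]
  ext x
  simp only [mem_iUnion]
  constructor
  · rintro ⟨p, hp, hx⟩
    exact ⟨t.equivFin ⟨p, hp⟩, by simpa using hx⟩
  · rintro ⟨i, hi⟩
    exact ⟨_, (t.equivFin.symm i).2, hi⟩

/-- A compact set that is a union of intervals of length at least `η` is a finite union of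
intervals. -/
lemma isFiniteUnionOfClosedIntervals_of_forall_exists {X : Set ℝ} (hX : IsCompact X) {η : ℝ}
    (hη : 0 < η)
    (h : ∀ x ∈ X, ∃ u v, x ∈ Icc u v ∧ η ≤ v - u ∧ Icc u v ⊆ X) :
    IsFiniteUnionOfClosedIntervals X := by
  classical
  set C : ℝ → Set ℝ := fun g => connectedComponentIn X g
  have hCconn : ∀ g ∈ X, IsConnected (C g) := fun g hg =>
    isConnected_connectedComponentIn_iff.2 hg
  have hCcomp : ∀ g ∈ X, IsCompact (C g) := by
    intro g hg
    refine hX.of_isClosed_subset ?_ (connectedComponentIn_subset X g)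
    refine isClosed_of_closure_subset ?_
    exact (hCconn g hg).isPreconnected.closure.subset_connectedComponentIn
      (subset_closure (mem_connectedComponentIn hg))
      (closure_minimal (connectedComponentIn_subset X g) hX.isClosed)
  have hCIcc : ∀ g ∈ X, C g = Icc (sInf (C g)) (sSup (C g)) := fun g hg =>
    eq_Icc_of_connected_compact (hCconn g hg) (hCcomp g hg)
  obtain ⟨R, hR⟩ := hX.isBounded.subset_closedBall 0
  -- An interval of length at least `η` meets the grid of multiples of `η`, and only finitely many
  -- grid points lie in the bounded set `X`; their components suffice.
  set T : Finset (ℝ × ℝ) :=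
    (((Finset.Icc ⌊-R / η⌋ ⌈R / η⌉).image fun k : ℤ => (k : ℝ) * η).filter (· ∈ X)).image
      (fun g => (sInf (C g), sSup (C g))) with hT
  refine isFiniteUnionOfClosedIntervals_of_finset (T.filter fun p => p.1 < p.2)
    (fun p hp => (Finset.mem_filter.1 hp).2) ?_
  apply Subset.antisymm
  · intro x hx
    obtain ⟨u, v, hxuv, hlen, hsub⟩ := h x hx
    have hg1 : u ≤ ⌈u / η⌉ * η := (div_le_iff₀ hη).1 (Int.le_ceil _)
    have hg2 : ⌈u / η⌉ * η ≤ v := by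
      have := Int.ceil_lt_add_one (u / η)
      have h2 : (⌈u / η⌉ : ℝ) * η < (u / η + 1) * η := mul_lt_mul_of_pos_right this hη
      rw [add_mul, div_mul_cancel₀ _ hη.ne'] at h2
      linarith
    set k := ⌈u / η⌉
    have hgX : (k : ℝ) * η ∈ X := hsub ⟨hg1, hg2⟩
    have huv : u ≤ v := by linarith
    have hsubC : Icc u v ⊆ C (k * η) :=
      isPreconnected_Icc.subset_connectedComponentIn ⟨hg1, hg2⟩ hsub
    have hball := hR hgX
    rw [mem_closedBall_zero_iff, Real.norm_eq_abs, abs_le] at hball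
    have hC := hCIcc _ hgX
    rw [hC] at hsubC
    have hu := hsubC (left_mem_Icc.2 huv)
    have hv := hsubC (right_mem_Icc.2 huv)
    simp only [mem_iUnion]
    refine ⟨(sInf (C (k * η)), sSup (C (k * η))), Finset.mem_filter.2 ⟨?_, ?_⟩, hsubC hxuv⟩
    · refine Finset.mem_image.2 ⟨k * η, Finset.mem_filter.2 ⟨Finset.mem_image.2 ⟨k, ?_, rfl⟩, hgX⟩,
        rfl⟩
      rw [Finset.mem_Icc]
      constructor
      · have : -R / η ≤ k := (div_le_iff₀ hη).2 hball.1
        exact_mod_cast (Int.floor_le _).trans this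
      · have : (k : ℝ) ≤ R / η := (le_div_iff₀ hη).2 hball.2
        exact_mod_cast this.trans (Int.le_ceil _)
    · show sInf (C (k * η)) < sSup (C (k * η))
      linarith [hu.1, hv.2]
  · refine iUnion₂_subset fun p hp => ?_
    obtain ⟨g, hg, rfl⟩ := Finset.mem_image.1 (Finset.mem_filter.1 hp).1
    have hgX := (Finset.mem_filter.1 hg).2
    show Icc (sInf (C g)) (sSup (C g)) ⊆ X
    rw [← hCIcc g hgX]
    exact connectedComponentIn_subset X g

/-! ### Existence and uniqueness of attractors -/

lemma hutchinson_mono (Ψ : Set (ℝ → ℝ)) {A B : Set ℝ} (h : A ⊆ B) :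
    hutchinson Ψ A ⊆ hutchinson Ψ B :=
  closure_mono (iUnion₂_mono fun _ _ => image_mono h)

/-- Zorn's lemma gives a minimal nonempty closed set that the operator sends into itself. Its image
under the operator is another such set, so minimality forces equality; no contraction is needed. -/
lemma exists_isInvariantCompact {Ψ : Set (ℝ → ℝ)} (hΨ : Ψ.Nonempty) {X B : Set ℝ}
    (hB : IsCompact B) (hB0 : B.Nonempty) (hBX : B ⊆ X) (hmaps : ∀ f ∈ Ψ, MapsTo f B B) :
    ∃ K, IsInvariantCompact Ψ X K := by
  set S : Set (Set ℝ) := {A | A.Nonempty ∧ IsClosed A ∧ A ⊆ B ∧ hutchinson Ψ A ⊆ A}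
  have hBS : B ∈ S := ⟨hB0, hB.isClosed, Subset.rfl, hB.isClosed.closure_subset_iff.2
    (iUnion₂_subset fun f hf => (hmaps f hf).image_subset)⟩
  obtain ⟨K, -, hK⟩ := zorn_superset_nonempty S (by
    intro c hcS hc hc0
    refine ⟨⋂₀ c, ⟨?_, ?_, ?_, ?_⟩, fun s hs => sInter_subset_of_mem hs⟩
    · have := hc0.to_subtype
      refine IsCompact.nonempty_sInter_of_directed_nonempty_isCompact_isClosed ?_
        (fun U hU => (hcS hU).1) (fun U hU => hB.of_isClosed_subset (hcS hU).2.1 (hcS hU).2.2.1)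
        (fun U hU => (hcS hU).2.1)
      intro s hs t ht
      rcases hc.total hs ht with hst | hts
      · exact ⟨s, hs, Subset.rfl, hst⟩
      · exact ⟨t, ht, hts, Subset.rfl⟩
    · exact isClosed_sInter fun U hU => (hcS hU).2.1
    · obtain ⟨U, hU⟩ := hc0
      exact (sInter_subset_of_mem hU).trans (hcS hU).2.2.1
    · exact subset_sInter fun U hU =>
        (hutchinson_mono Ψ (sInter_subset_of_mem hU)).trans (hcS hU).2.2.2) B hBS
  obtain ⟨hK0, hKc, hKB, hKs⟩ := hK.prop
  refine ⟨K, hK0, hB.of_isClosed_subset hKc hKB, hKB.trans hBX, ?_⟩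
  refine hKs.antisymm (hK.2 ⟨?_, isClosed_closure, hKs.trans hKB, hutchinson_mono Ψ hKs⟩ hKs)
  obtain ⟨f, hf⟩ := hΨ
  obtain ⟨x, hx⟩ := hK0
  exact ⟨f x, subset_closure (mem_iUnion₂.2 ⟨f, hf, mem_image_of_mem f hx⟩)⟩

lemma IsInvariantCompact.image_mem {Ψ : Set (ℝ → ℝ)} {X K : Set ℝ}
    (hK : IsInvariantCompact Ψ X K) {f : ℝ → ℝ} (hf : f ∈ Ψ) {x : ℝ} (hx : x ∈ K) : f x ∈ K := by
  rw [← hK.fixed]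
  exact subset_closure (mem_iUnion₂.2 ⟨f, hf, mem_image_of_mem f hx⟩)

/-- The largest distance from a point of `K` to `K'` is at most `δ` times itself, hence zero. -/
lemma IsInvariantCompact.subset_of_contraction {Ψ : Set (ℝ → ℝ)} {X K K' : Set ℝ} {δ : ℝ}
    (hδ : δ < 1) (hδ0 : 0 ≤ δ)
    (hcontr : ∀ f ∈ Ψ, ∀ x ∈ X, ∀ y ∈ X, |f x - f y| ≤ δ * |x - y|)
    (hK : IsInvariantCompact Ψ X K) (hK' : IsInvariantCompact Ψ X K') : K ⊆ K' := by
  have hc : Continuous fun x : ℝ => Metric.infDist x K' := Metric.continuous_infDist_pt K'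
  obtain ⟨x₀, hx₀, hmax⟩ := hK.isCompact.exists_isMaxOn hK.nonempty hc.continuousOn
  have hsub : K ⊆ {x | Metric.infDist x K' ≤ δ * Metric.infDist x₀ K'} := by
    conv_lhs => rw [← hK.fixed]
    refine closure_minimal ?_ (isClosed_le hc continuous_const)
    refine iUnion₂_subset fun f hf => ?_
    rintro _ ⟨y, hy, rfl⟩
    obtain ⟨z, hz, hyz⟩ := hK'.isCompact.exists_infDist_eq_dist hK'.nonempty y
    calc Metric.infDist (f y) K' ≤ dist (f y) (f z) :=
          Metric.infDist_le_dist_of_mem (hK'.image_mem hf hz)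
      _ ≤ δ * |y - z| := hcontr f hf y (hK.subset hy) z (hK'.subset hz)
      _ = δ * Metric.infDist y K' := by rw [hyz, Real.dist_eq]
      _ ≤ δ * Metric.infDist x₀ K' := mul_le_mul_of_nonneg_left (hmax hy) hδ0
  have h0 : Metric.infDist x₀ K' ≤ 0 := by
    have h1 : Metric.infDist x₀ K' ≤ δ * Metric.infDist x₀ K' := hsub hx₀
    nlinarith
  intro x hx
  rw [hK'.isCompact.isClosed.mem_iff_infDist_zero hK'.nonempty]
  exact le_antisymm ((hmax hx).trans h0) Metric.infDist_nonneg

lemma IsInvariantCompact.isAttractor {Ψ : Set (ℝ → ℝ)} {X K : Set ℝ} {δ : ℝ}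
    (hδ : δ < 1) (hδ0 : 0 ≤ δ)
    (hcontr : ∀ f ∈ Ψ, ∀ x ∈ X, ∀ y ∈ X, |f x - f y| ≤ δ * |x - y|)
    (hK : IsInvariantCompact Ψ X K) : IsAttractor Ψ X K :=
  ⟨hK, fun _ hK' => (hK'.subset_of_contraction hδ hδ0 hcontr hK).antisymm
    (hK.subset_of_contraction hδ hδ0 hcontr hK')⟩

/-! ### Second generation systems -/

lemma exists_isAttractor_secondGeneration {α : ℝ} (h0 : 0 < α) (h1 : α < 1) {K : Set ℝ}
    (hK : IsCompact K) (hK0 : K.Nonempty) :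
    ∃ X, IsAttractor (secondGeneration α K) univ X := by
  obtain ⟨R, hR⟩ := hK.isBounded.subset_closedBall 0
  simp only [Real.closedBall_eq_Icc, zero_sub, zero_add] at hR
  obtain ⟨x, hx⟩ := hK0
  obtain ⟨X, hX⟩ := exists_isInvariantCompact (Ψ := secondGeneration α K) (X := univ)
    (Set.Nonempty.image _ ⟨x, hx⟩) (isCompact_Icc (a := -R) (b := R)) ⟨x, hR hx⟩ (subset_univ _) (by
      rintro _ ⟨β, hβ, rfl⟩ y ⟨hy1, hy2⟩
      obtain ⟨hb1, hb2⟩ := hR hβ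
      simp only [affineMap]
      constructor <;> nlinarith)
  refine ⟨X, hX.isAttractor h1 h0.le ?_⟩
  rintro _ ⟨β, hβ, rfl⟩ x - y -
  simp only [affineMap]
  rw [show α * x + (1 - α) * β - (α * y + (1 - α) * β) = α * (x - y) by ring, abs_mul,
    abs_of_pos h0]

lemma exists_eq_of_mem_secondGeneration {α : ℝ} {K X : Set ℝ} (hK : IsCompact K)
    (hX : IsInvariantCompact (secondGeneration α K) univ X) {x : ℝ} (hx : x ∈ X) :
    ∃ y ∈ X, ∃ β ∈ K, x = α * y + (1 - α) * β := by
  have hcl : IsClosed ((fun p : ℝ × ℝ => α * p.1 + (1 - α) * p.2) '' X ×ˢ K) :=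
    ((hX.isCompact.prod hK).image (by fun_prop)).isClosed
  have hsub : hutchinson (secondGeneration α K) X ⊆
      (fun p : ℝ × ℝ => α * p.1 + (1 - α) * p.2) '' X ×ˢ K := by
    refine closure_minimal (iUnion₂_subset ?_) hcl
    rintro _ ⟨β, hβ, rfl⟩ _ ⟨y, hy, rfl⟩
    exact ⟨(y, β), ⟨hy, hβ⟩, rfl⟩
  rw [hX.fixed] at hsub
  obtain ⟨⟨y, β⟩, ⟨hy, hβ⟩, rfl⟩ := hsub hx
  exact ⟨y, hy, β, hβ, rfl⟩

lemma exists_expansion {α : ℝ} {K X : Set ℝ} (hK : IsCompact K) (hK0 : K.Nonempty)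
    (hX : IsInvariantCompact (secondGeneration α K) univ X) (N : ℕ) {x : ℝ} (hx : x ∈ X) :
    ∃ y ∈ X, ∃ β : ℕ → ℝ, (∀ k, β k ∈ K) ∧
      x = α ^ N * y + ∑ k ∈ Finset.range N, (1 - α) * α ^ k * β k := by
  induction N with
  | zero =>
    obtain ⟨β, hβ⟩ := hK0
    exact ⟨x, hx, fun _ => β, fun _ => hβ, by simp⟩
  | succ N ih =>
    obtain ⟨y, hy, β, hβ, rfl⟩ := ih
    obtain ⟨y', hy', β', hβ', rfl⟩ := exists_eq_of_mem_secondGeneration hK hX hy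
    refine ⟨y', hy', Function.update β N β', fun k => ?_, ?_⟩
    · rcases eq_or_ne k N with rfl | hk
      · simpa using hβ'
      · simpa [hk] using hβ k
    · rw [Finset.sum_range_succ, Function.update_self]
      have : ∑ k ∈ Finset.range N, (1 - α) * α ^ k * Function.update β N β' k =
          ∑ k ∈ Finset.range N, (1 - α) * α ^ k * β k :=
        Finset.sum_congr rfl fun k hk => by
          rw [Function.update_of_ne (Finset.mem_range.1 hk).ne]
      rw [this]
      ring

lemma expansion_mem {α : ℝ} {K X : Set ℝ}
    (hX : IsInvariantCompact (secondGeneration α K) univ X) {β : ℕ → ℝ} (hβ : ∀ k, β k ∈ K)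
    (N : ℕ) {y : ℝ} (hy : y ∈ X) :
    α ^ N * y + ∑ k ∈ Finset.range N, (1 - α) * α ^ k * β k ∈ X := by
  induction N generalizing y with
  | zero => simpa using hy
  | succ N ih =>
    have := ih (hX.image_mem (mem_image_of_mem (affineMap α) (hβ N)) hy)
    rw [Finset.sum_range_succ]
    convert this using 1
    simp only [affineMap]
    ring

theorem UniformDissection.exists_attractor {A : Type*} {a b : List A → ℝ} {r : ℝ} {K : Set ℝ}
    (h : UniformDissection a b r K) (hK : IsCompact K) {α : ℝ} (h0 : 0 < α) (h1 : α < 1) :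
    ∃ X, IsAttractor (secondGeneration α K) univ X ∧ IsFiniteUnionOfClosedIntervals X := by
  have hK0 : K.Nonempty := ⟨_, h.left_mem []⟩
  obtain ⟨X, hX⟩ := exists_isAttractor_secondGeneration h0 h1 hK hK0
  refine ⟨X, hX, ?_⟩
  have hr := h.pos
  -- One more than `1 / r` terms, since only the terms other than the longest count in `hcard`.
  obtain ⟨n, hn⟩ := exists_nat_ge (1 / r)
  set N := n + 1 with hN
  have hcard : 1 ≤ r * (((Finset.range N).card : ℝ) - 1) := by
    rw [div_le_iff₀ hr] at hn
    simp only [Finset.card_range, hN]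
    push_cast
    linarith
  have hne : (Finset.range N).Nonempty := ⟨0, by simp [hN]⟩
  set L := b [] - a [] with hL
  have hLpos : 0 < L := sub_pos.2 (h.lt [])
  have h1α : 0 < 1 - α := by linarith
  -- Common scale of the weighted intervals: the digit of weight `(1 - α) * α ^ k` needs a tree
  -- interval of size about `α ^ (N - k) * L`, which does not exceed the root length `L`.
  set E := (1 - α) * (α ^ N * L) with hE
  have hEpos : 0 < E := by positivity
  refine isFiniteUnionOfClosedIntervals_of_forall_exists hX.1.isCompact
    (η := r * E) (by positivity) fun x hx => ?_
  obtain ⟨y, hy, β, hβ, rfl⟩ := exists_expansion hK hK0 hX.1 N hx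
  have hchoice : ∀ k : ℕ, ∃ w, k < N → β k ∈ Icc (a w) (b w) ∧
      r * E ≤ (1 - α) * α ^ k * (b w - a w) ∧ (1 - α) * α ^ k * (b w - a w) ≤ E := by
    intro k
    by_cases hk : k < N
    · obtain ⟨w, hw, hw1, hw2⟩ := h.exists_mem_scale (ε := α ^ (N - k) * L) (by positivity)
        (mul_le_of_le_one_left hLpos.le (pow_le_one₀ h0.le h1.le)) (hβ k)
      have hpow : (1 - α) * α ^ k * (α ^ (N - k) * L) = E := by
        rw [hE, ← Nat.add_sub_of_le hk.le, Nat.add_sub_cancel_left, pow_add]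
        ring
      have hpos : 0 < (1 - α) * α ^ k := by positivity
      refine ⟨w, fun _ => ⟨hw, ?_, ?_⟩⟩
      · rw [← hpow]
        linarith [mul_le_mul_of_nonneg_left hw1 hpos.le]
      · rw [← hpow]
        exact mul_le_mul_of_nonneg_left hw2 hpos.le
    · exact ⟨[], fun hk' => (hk hk').elim⟩
  choose w hw using hchoice
  have hc : ∀ k, 0 < (1 - α) * α ^ k := fun k => by positivity
  refine ⟨α ^ N * y + ∑ k ∈ Finset.range N, (1 - α) * α ^ k * a (w k),
    α ^ N * y + ∑ k ∈ Finset.range N, (1 - α) * α ^ k * b (w k), ⟨?_, ?_⟩, ?_, ?_⟩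
  · gcongr with k hk
    exact (hw k (Finset.mem_range.1 hk)).1.1
  · gcongr with k hk
    exact (hw k (Finset.mem_range.1 hk)).1.2
  · rw [add_sub_add_left_eq_sub, ← Finset.sum_sub_distrib]
    simp only [← mul_sub]
    refine (hw 0 (by simp [hN])).2.1.trans ?_
    refine Finset.single_le_sum
      (f := fun k => (1 - α) * α ^ k * (b (w k) - a (w k)))
      (fun k _ => mul_nonneg (hc k).le (sub_nonneg.2 (h.lt _).le)) (by simp [hN])
  · intro t ht
    obtain ⟨ξ, hξ, hsum⟩ := h.Icc_subset_sum hK (Finset.range N) hne hcard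
      (fun k => (1 - α) * α ^ k) (fun k _ => hc k) w (by
        intro i hi k hk
        exact (mul_le_mul_of_nonneg_left (hw i (Finset.mem_range.1 hi)).2.2 hr.le).trans
          (hw k (Finset.mem_range.1 hk)).2.1) (t := t - α ^ N * y)
      ⟨by linarith [ht.1], by linarith [ht.2]⟩
    have := expansion_mem hX.1 hξ N hy
    rw [hsum] at this
    simpa using this

/-! ### Uniformly lower bounded dissections -/

namespace Construction

variable (C : Construction)

lemma lt (w : List Bool) : C.a w < C.b w :=
  (C.lt_left w).trans ((C.lt_gap w).trans (C.lt_right w))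

lemma left_le (w : List Bool) (j : Bool) : C.a w ≤ C.a (w ++ [j]) := by
  cases j
  · exact (C.left_eq w).ge
  · exact ((C.lt_left w).trans (C.lt_gap w)).le

lemma right_le (w : List Bool) (j : Bool) : C.b (w ++ [j]) ≤ C.b w := by
  cases j
  · exact ((C.lt_gap w).trans (C.lt_right w)).le
  · exact (C.right_eq w).le

lemma interval_append_subset (w v : List Bool) : C.interval (w ++ v) ⊆ C.interval w := by
  induction v using List.reverseRecOn with
  | nil => simp
  | append_singleton v j ih =>
    rw [← List.append_assoc]
    exact (Icc_subset_Icc (C.left_le _ j) (C.right_le _ j)).trans ih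

lemma left_append_replicate (w : List Bool) (n : ℕ) :
    C.a (w ++ List.replicate n false) = C.a w := by
  induction n with
  | zero => simp
  | succ n ih => rw [List.replicate_succ', ← List.append_assoc, C.left_eq, ih]

lemma right_append_replicate (w : List Bool) (n : ℕ) :
    C.b (w ++ List.replicate n true) = C.b w := by
  induction n with
  | zero => simp
  | succ n ih => rw [List.replicate_succ', ← List.append_assoc, C.right_eq, ih]

lemma mem_limitSet_of_forall_exists {x : ℝ} (w : List Bool)
    (h : ∀ n, ∃ v : List Bool, v.length = n ∧ x ∈ C.interval (w ++ v)) : x ∈ C.limitSet := by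
  refine mem_iInter.2 fun n => ?_
  obtain ⟨v, hv, hx⟩ := h n
  -- Truncating a word enlarges its interval.
  refine mem_iUnion₂.2 ⟨(w ++ v).take n, by simp [hv], ?_⟩
  apply C.interval_append_subset _ ((w ++ v).drop n)
  rwa [List.take_append_drop]

lemma left_mem_limitSet (w : List Bool) : C.a w ∈ C.limitSet := by
  refine C.mem_limitSet_of_forall_exists w fun n => ⟨List.replicate n false, by simp, ?_⟩
  rw [← C.left_append_replicate w n]
  exact left_mem_Icc.2 (C.lt _).le

lemma right_mem_limitSet (w : List Bool) : C.b w ∈ C.limitSet := by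
  refine C.mem_limitSet_of_forall_exists w fun n => ⟨List.replicate n true, by simp, ?_⟩
  rw [← C.right_append_replicate w n]
  exact right_mem_Icc.2 (C.lt _).le

lemma uniformDissection {r : ℝ} (hr : 0 < r) (h : ∀ w j, r ≤ C.ratio w j) :
    UniformDissection C.a C.b r C.limitSet := by
  have hle : ∀ w j, r * (C.b w - C.a w) ≤ C.b (w ++ [j]) - C.a (w ++ [j]) := fun w j =>
    (le_div_iff₀ (sub_pos.2 (C.lt w))).1 (h w j)
  exact
    { pos := hr
      lt := C.lt
      left_mem := C.left_mem_limitSet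
      right_mem := C.right_mem_limitSet
      left_le := C.left_le
      right_le := C.right_le
      le_ratio := hle
      -- The sibling is disjoint from the child and fills at least the fraction `r` of the parent.
      ratio_le := fun w j => by
        have h1 := hle w (!j)
        have h2 := C.left_eq w
        have h3 := C.right_eq w
        have h4 := C.lt_gap w
        cases j <;> simp only [Bool.not_false, Bool.not_true] at h1 <;> linarith
      exists_left := fun w => ⟨false, C.left_eq w⟩
      exists_right := fun w => ⟨true, C.right_eq w⟩
      cover := fun x hx n => by
        obtain ⟨w, hw, hxw⟩ := mem_iUnion₂.1 (mem_iInter.1 hx n)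
        exact ⟨w, hw, hxw⟩ }

end Construction

/-! ### Compositions of contractions with bounded distortion -/

/-- A strictly monotone map of `H` into itself, bi-Lipschitz with constants `σ` and `δ`, whose
difference quotients on sets of diameter at most `ℓ` agree up to a factor `1 + κ ℓ`. -/
structure IsDistortionBounded (f : ℝ → ℝ) (H : Set ℝ) (σ δ κ : ℝ) : Prop where
  mapsTo : MapsTo f H H
  monotone : StrictMonoOn f H ∨ StrictAntiOn f H
  le_abs_sub : ∀ x ∈ H, ∀ y ∈ H, σ * |x - y| ≤ |f x - f y|
  abs_sub_le : ∀ x ∈ H, ∀ y ∈ H, |f x - f y| ≤ δ * |x - y|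
  distortion : ∀ x ∈ H, ∀ y ∈ H, ∀ z ∈ H, ∀ v ∈ H, ∀ ℓ, |x - z| ≤ ℓ → |x - v| ≤ ℓ →
    |y - z| ≤ ℓ → |y - v| ≤ ℓ → |f x - f y| * |z - v| ≤ (1 + κ * ℓ) * (|f z - f v| * |x - y|)

/-- The composition of the maps of `ψ` along a word. -/
def wordMap {A : Type*} (ψ : A → ℝ → ℝ) (w : List A) : ℝ → ℝ :=
  w.foldr (fun i g => ψ i ∘ g) id

section wordMap

variable {A : Type*} {ψ : A → ℝ → ℝ} {H : Set ℝ} {σ δ κ : ℝ}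

@[simp] lemma wordMap_nil (x : ℝ) : wordMap ψ [] x = x := rfl

@[simp] lemma wordMap_cons (i : A) (w : List A) (x : ℝ) :
    wordMap ψ (i :: w) x = ψ i (wordMap ψ w x) := rfl

lemma wordMap_append_singleton (w : List A) (i : A) (x : ℝ) :
    wordMap ψ (w ++ [i]) x = wordMap ψ w (ψ i x) := by
  induction w with
  | nil => rfl
  | cons j w ih => simp [ih]

lemma mapsTo_wordMap (h : ∀ i, MapsTo (ψ i) H H) (w : List A) : MapsTo (wordMap ψ w) H H := by
  induction w with
  | nil => exact mapsTo_id H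
  | cons i w ih => exact (h i).comp ih

lemma wordMap_monotone (h : ∀ i, IsDistortionBounded (ψ i) H σ δ κ) (w : List A) :
    StrictMonoOn (wordMap ψ w) H ∨ StrictAntiOn (wordMap ψ w) H := by
  induction w with
  | nil => exact Or.inl strictMonoOn_id
  | cons i w ih =>
    have hm := mapsTo_wordMap (fun i => (h i).mapsTo) w
    rcases (h i).monotone with hi | hi <;> rcases ih with hw | hw
    · exact Or.inl (hi.comp hw hm)
    · exact Or.inr (hi.comp_strictAntiOn hw hm)
    · exact Or.inr (hi.comp_strictMonoOn hw hm)
    · exact Or.inl (hi.comp hw hm)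

lemma wordMap_abs_sub_le (h : ∀ i, IsDistortionBounded (ψ i) H σ δ κ) (hδ : 0 ≤ δ) (w : List A)
    {x y : ℝ} (hx : x ∈ H) (hy : y ∈ H) :
    |wordMap ψ w x - wordMap ψ w y| ≤ δ ^ w.length * |x - y| := by
  induction w with
  | nil => simp
  | cons i w ih =>
    have hm := mapsTo_wordMap (fun i => (h i).mapsTo) w
    rw [List.length_cons, pow_succ', mul_assoc]
    exact ((h i).abs_sub_le _ (hm hx) _ (hm hy)).trans (mul_le_mul_of_nonneg_left ih hδ)

/-- Prepending a letter applies its map to an image of diameter at most `δ ^ w.length * L`, which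
costs a factor `1 + κ * (δ ^ w.length * L)`, bounded by an exponential. Difference quotients are
compared in cross-multiplied form. -/
lemma wordMap_distortion_sum (h : ∀ i, IsDistortionBounded (ψ i) H σ δ κ) (hδ : 0 ≤ δ)
    {L : ℝ} (hL : ∀ x ∈ H, ∀ y ∈ H, |x - y| ≤ L) (w : List A)
    {x y z v : ℝ} (hx : x ∈ H) (hy : y ∈ H) (hz : z ∈ H) (hv : v ∈ H) :
    |wordMap ψ w x - wordMap ψ w y| * |z - v| ≤
      Real.exp (κ * L * ∑ k ∈ Finset.range w.length, δ ^ k) *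
        (|wordMap ψ w z - wordMap ψ w v| * |x - y|) := by
  induction w with
  | nil => simp [mul_comm]
  | cons i w ih =>
    have hm := mapsTo_wordMap (fun i => (h i).mapsTo) w
    rcases eq_or_ne z v with rfl | hzv
    · simp
    have hinj : InjOn (wordMap ψ w) H :=
      (wordMap_monotone h w).elim StrictMonoOn.injOn StrictAntiOn.injOn
    have hpos : 0 < |wordMap ψ w z - wordMap ψ w v| :=
      abs_pos.2 (sub_ne_zero.2 fun he => hzv (hinj hz hv he))
    have hsmall : ∀ s ∈ H, ∀ t ∈ H, |wordMap ψ w s - wordMap ψ w t| ≤ δ ^ w.length * L :=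
      fun s hs t ht => (wordMap_abs_sub_le h hδ w hs ht).trans
        (mul_le_mul_of_nonneg_left (hL s hs t ht) (pow_nonneg hδ _))
    have hd := (h i).distortion _ (hm hx) _ (hm hy) _ (hm hz) _ (hm hv) _ (hsmall x hx z hz)
      (hsmall x hx v hv) (hsmall y hy z hz) (hsmall y hy v hv)
    have hexp : 1 + κ * (δ ^ w.length * L) ≤ Real.exp (κ * L * δ ^ w.length) := by
      linarith [Real.add_one_le_exp (κ * L * δ ^ w.length)]
    rw [List.length_cons, Finset.sum_range_succ, mul_add, Real.exp_add]
    set E := Real.exp (κ * L * ∑ k ∈ Finset.range w.length, δ ^ k)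
    set F := Real.exp (κ * L * δ ^ w.length)
    simp only [wordMap_cons]
    set X := |ψ i (wordMap ψ w x) - ψ i (wordMap ψ w y)|
    set Z := |ψ i (wordMap ψ w z) - ψ i (wordMap ψ w v)|
    refine le_of_mul_le_mul_right ?_ hpos
    have hF : 0 < F := Real.exp_pos _
    calc X * |z - v| * |wordMap ψ w z - wordMap ψ w v|
        = X * |wordMap ψ w z - wordMap ψ w v| * |z - v| := by ring
      _ ≤ (1 + κ * (δ ^ w.length * L)) * (Z * |wordMap ψ w x - wordMap ψ w y|) * |z - v| :=
          mul_le_mul_of_nonneg_right hd (abs_nonneg _)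
      _ ≤ F * (Z * |wordMap ψ w x - wordMap ψ w y|) * |z - v| := by gcongr
      _ = F * Z * (|wordMap ψ w x - wordMap ψ w y| * |z - v|) := by ring
      _ ≤ F * Z * (E * (|wordMap ψ w z - wordMap ψ w v| * |x - y|)) := by gcongr
      _ = E * F * (Z * |x - y|) * |wordMap ψ w z - wordMap ψ w v| := by ring

lemma exists_wordMap_distortion (h : ∀ i, IsDistortionBounded (ψ i) H σ δ κ) (hδ : 0 ≤ δ)
    (hδ1 : δ < 1) (hκ : 0 ≤ κ) {L : ℝ} (hL0 : 0 ≤ L) (hL : ∀ x ∈ H, ∀ y ∈ H, |x - y| ≤ L) :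
    ∃ D : ℝ, 0 < D ∧ ∀ (w : List A), ∀ x ∈ H, ∀ y ∈ H, ∀ z ∈ H, ∀ v ∈ H,
      |wordMap ψ w x - wordMap ψ w y| * |z - v| ≤
        D * (|wordMap ψ w z - wordMap ψ w v| * |x - y|) := by
  refine ⟨Real.exp (κ * L * (1 - δ)⁻¹), Real.exp_pos _, fun w x hx y hy z hz v hv =>
    (wordMap_distortion_sum h hδ hL w hx hy hz hv).trans ?_⟩
  gcongr
  rw [← tsum_geometric_of_lt_one hδ hδ1]
  exact (summable_geometric_of_lt_one hδ hδ1).sum_le_tsum _ fun k _ => pow_nonneg hδ k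

lemma abs_sub_eq_add_of_strictMonoOn_or {f : ℝ → ℝ} (h : StrictMonoOn f H ∨ StrictAntiOn f H)
    {x y z : ℝ} (hx : x ∈ H) (hy : y ∈ H) (hz : z ∈ H) (hxy : x ≤ y) (hyz : y ≤ z) :
    |f z - f x| = |f z - f y| + |f y - f x| := by
  rcases h with h | h
  · have h1 := h.monotoneOn hx hy hxy
    have h2 := h.monotoneOn hy hz hyz
    rw [abs_of_nonneg, abs_of_nonneg, abs_of_nonneg] <;> linarith
  · have h1 := h.antitoneOn hx hy hxy
    have h2 := h.antitoneOn hy hz hyz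
    rw [abs_of_nonpos, abs_of_nonpos, abs_of_nonpos] <;> linarith

lemma mem_Icc_min_max_of_strictMonoOn_or {f : ℝ → ℝ} {p q : ℝ}
    (h : StrictMonoOn f (Icc p q) ∨ StrictAntiOn f (Icc p q)) {x : ℝ} (hx : x ∈ Icc p q) :
    f x ∈ Icc (min (f p) (f q)) (max (f p) (f q)) := by
  have hpq := hx.1.trans hx.2
  have hp := left_mem_Icc.2 hpq
  have hq := right_mem_Icc.2 hpq
  rcases h with h | h
  · exact ⟨min_le_of_left_le (h.monotoneOn hp hx hx.1),
      le_max_of_le_right (h.monotoneOn hx hq hx.2)⟩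
  · exact ⟨min_le_of_right_le (h.antitoneOn hx hq hx.2),
      le_max_of_le_left (h.antitoneOn hp hx hx.1)⟩

/-- The images of the hull of an invariant set under the compositions of the maps form a tree of
intervals with uniformly bounded ratios. -/
theorem exists_uniformDissection_of_isDistortionBounded {K : Set ℝ} {p q : ℝ} (hpq : p < q)
    (hp : IsLeast K p) (hq : IsGreatest K q) (hσ : 0 < σ) (hδ : 0 ≤ δ) (hδ1 : δ < 1) (hκ : 0 ≤ κ)
    (h : ∀ i, IsDistortionBounded (ψ i) (Icc p q) σ δ κ) (hK : K = ⋃ i, ψ i '' K) :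
    ∃ (a b : List A → ℝ) (r : ℝ), UniformDissection a b r K := by
  have hKH : K ⊆ Icc p q := fun x hx => ⟨hp.2 hx, hq.2 hx⟩
  have hpH := left_mem_Icc.2 hpq.le
  have hqH := right_mem_Icc.2 hpq.le
  have hψK : ∀ i, MapsTo (ψ i) K K := fun i x hx => by
    rw [hK]; exact mem_iUnion.2 ⟨i, mem_image_of_mem _ hx⟩
  have hmono := wordMap_monotone h
  obtain ⟨D, hD, hdist⟩ := exists_wordMap_distortion h hδ hδ1 hκ (sub_nonneg.2 hpq.le)
    (fun x hx y hy => abs_sub_le_iff.2 ⟨by linarith [hx.2, hy.1], by linarith [hx.1, hy.2]⟩)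
  have hpq' : 0 < |q - p| := abs_pos.2 (sub_pos.2 hpq).ne'
  -- An extreme point of `K` is some `ψ j y`, which lies between `ψ j p` and `ψ j q`; these are
  -- themselves in `[p, q]`, so one of them equals it.
  have hendpt : ∀ e ∈ K, (e = p ∨ e = q) → ∃ j, ψ j p = e ∨ ψ j q = e := by
    intro e he hepq
    rw [hK] at he
    obtain ⟨j, y, hy, hye⟩ := mem_iUnion.1 he
    refine ⟨j, ?_⟩
    have hyH := hKH hy
    have hpj := (h j).mapsTo hpH
    have hqj := (h j).mapsTo hqH
    obtain ⟨h1, h2⟩ := mem_Icc_min_max_of_strictMonoOn_or (h j).monotone hyH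
    rcases hepq with rfl | rfl
    · rw [hye] at h1
      rcases min_le_iff.1 h1 with h3 | h3
      · exact Or.inl (le_antisymm h3 hpj.1)
      · exact Or.inr (le_antisymm h3 hqj.1)
    · rw [hye] at h2
      rcases le_max_iff.1 h2 with h3 | h3
      · exact Or.inl (le_antisymm hpj.2 h3)
      · exact Or.inr (le_antisymm hqj.2 h3)
  set a : List A → ℝ := fun w => min (wordMap ψ w p) (wordMap ψ w q) with ha
  set b : List A → ℝ := fun w => max (wordMap ψ w p) (wordMap ψ w q) with hb
  have hlen : ∀ w, b w - a w = |wordMap ψ w q - wordMap ψ w p| := fun w => by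
    rw [abs_sub_comm]; exact max_sub_min_eq_abs' _ _
  have hmemIcc : ∀ w, ∀ x ∈ Icc p q, wordMap ψ w x ∈ Icc (a w) (b w) := fun w x hx =>
    mem_Icc_min_max_of_strictMonoOn_or (hmono w) hx
  have hchild : ∀ w j, (a (w ++ [j]) ∈ Icc (a w) (b w)) ∧ (b (w ++ [j]) ∈ Icc (a w) (b w)) := by
    intro w j
    have h1 := hmemIcc w _ ((h j).mapsTo hpH)
    have h2 := hmemIcc w _ ((h j).mapsTo hqH)
    simp only [ha, hb, wordMap_append_singleton] at h1 h2 ⊢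
    exact ⟨⟨le_min h1.1 h2.1, min_le_of_left_le h1.2⟩, ⟨le_max_of_le_left h1.1, max_le h1.2 h2.2⟩⟩
  have hend_mem : ∀ w, wordMap ψ w p ∈ K ∧ wordMap ψ w q ∈ K := fun w =>
    ⟨mapsTo_wordMap hψK w hp.1, mapsTo_wordMap hψK w hq.1⟩
  -- Up to the distortion `D`, a child fills at least the fraction `σ` of its parent and misses at
  -- least the fraction `1 - δ`.
  refine ⟨a, b, min σ (1 - δ) / D, ?_⟩
  have hr : 0 < min σ (1 - δ) / D := div_pos (lt_min hσ (by linarith)) hD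
  exact
    { pos := hr
      lt := fun w => by
        have hinj : InjOn (wordMap ψ w) (Icc p q) :=
          (hmono w).elim StrictMonoOn.injOn StrictAntiOn.injOn
        rw [← sub_pos, hlen]
        exact abs_pos.2 (sub_ne_zero.2 fun he => hpq.ne' (hinj hqH hpH he))
      left_mem := fun w => by
        rcases min_choice (wordMap ψ w p) (wordMap ψ w q) with h1 | h1 <;> simp only [ha, h1]
        exacts [(hend_mem w).1, (hend_mem w).2]
      right_mem := fun w => by
        rcases max_choice (wordMap ψ w p) (wordMap ψ w q) with h1 | h1 <;> simp only [hb, h1]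
        exacts [(hend_mem w).1, (hend_mem w).2]
      left_le := fun w j => (hchild w j).1.1
      right_le := fun w j => (hchild w j).2.2
      le_ratio := fun w j => by
        rw [hlen, hlen, div_mul_eq_mul_div, div_le_iff₀ hD]
        simp only [wordMap_append_singleton]
        have h1 := hdist w q hqH p hpH _ ((h j).mapsTo hqH) _ ((h j).mapsTo hpH)
        have h2 := (h j).le_abs_sub q hqH p hpH
        have h3 := mul_le_mul_of_nonneg_left h2 (abs_nonneg (wordMap ψ w q - wordMap ψ w p))
        refine le_of_mul_le_mul_right ?_ hpq'
        have h4 : min σ (1 - δ) * |wordMap ψ w q - wordMap ψ w p| * |q - p| ≤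
            σ * |wordMap ψ w q - wordMap ψ w p| * |q - p| := by
          gcongr
          exact min_le_left _ _
        linarith
      ratio_le := fun w j => by
        rw [hlen, hlen]
        simp only [wordMap_append_singleton]
        have hsplit : ∃ c ∈ Icc p q, ∃ d ∈ Icc p q, c ≤ d ∧ d - c ≤ δ * (q - p) ∧
            |wordMap ψ w (ψ j q) - wordMap ψ w (ψ j p)| = |wordMap ψ w d - wordMap ψ w c| := by
          have h2 := (h j).abs_sub_le q hqH p hpH
          rw [abs_of_pos (sub_pos.2 hpq), abs_le] at h2
          rcases le_total (ψ j p) (ψ j q) with h3 | h3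
          · exact ⟨_, (h j).mapsTo hpH, _, (h j).mapsTo hqH, h3, h2.2, rfl⟩
          · exact ⟨_, (h j).mapsTo hqH, _, (h j).mapsTo hpH, h3, by linarith, abs_sub_comm _ _⟩
        obtain ⟨c, hc, d, hd, hcd, hdc, heq⟩ := hsplit
        rw [heq]
        -- The parent splits into the child and the images of `[p, c]` and `[d, q]`, whose total
        -- length before mapping is at least `(1 - δ) * (q - p)`.
        have e1 := abs_sub_eq_add_of_strictMonoOn_or (hmono w) hpH hc hqH hc.1 hc.2
        have e2 := abs_sub_eq_add_of_strictMonoOn_or (hmono w) hc hd hqH hcd hd.2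
        have d1 := hdist w q hqH p hpH c hc p hpH
        have d2 := hdist w q hqH p hpH q hqH d hd
        rw [abs_of_nonneg (sub_nonneg.2 hc.1), abs_of_pos (sub_pos.2 hpq)] at d1
        rw [abs_of_nonneg (sub_nonneg.2 hd.2), abs_of_pos (sub_pos.2 hpq)] at d2
        set T := |wordMap ψ w q - wordMap ψ w p|
        set U := |wordMap ψ w d - wordMap ψ w c|
        have hT : 0 ≤ T := abs_nonneg _
        have h5 : (1 - δ) * T * (q - p) ≤ D * (T - U) * (q - p) := by
          have := mul_le_mul_of_nonneg_left hdc hT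
          have e3 : T - U = |wordMap ψ w q - wordMap ψ w d| + |wordMap ψ w c - wordMap ψ w p| := by
            linarith
          rw [e3]
          nlinarith
        have h6 := le_of_mul_le_mul_right h5 (sub_pos.2 hpq)
        have h7 : min σ (1 - δ) / D * T ≤ T - U := by
          rw [div_mul_eq_mul_div, div_le_iff₀ hD]
          have := mul_le_mul_of_nonneg_right (min_le_right σ (1 - δ)) hT
          linarith
        linarith
      exists_left := fun w => by
        obtain ⟨e, he, heK, hae⟩ : ∃ e, (e = p ∨ e = q) ∧ e ∈ K ∧ a w = wordMap ψ w e := by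
          rcases min_choice (wordMap ψ w p) (wordMap ψ w q) with h1 | h1
          · exact ⟨p, Or.inl rfl, hp.1, h1⟩
          · exact ⟨q, Or.inr rfl, hq.1, h1⟩
        obtain ⟨j, hj⟩ := hendpt e heK he
        refine ⟨j, le_antisymm ?_ (hchild w j).1.1⟩
        rw [hae]
        simp only [ha, wordMap_append_singleton]
        rcases hj with hj | hj <;> rw [hj]
        exacts [min_le_left _ _, min_le_right _ _]
      exists_right := fun w => by
        obtain ⟨e, he, heK, hbe⟩ : ∃ e, (e = p ∨ e = q) ∧ e ∈ K ∧ b w = wordMap ψ w e := by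
          rcases max_choice (wordMap ψ w p) (wordMap ψ w q) with h1 | h1
          · exact ⟨p, Or.inl rfl, hp.1, h1⟩
          · exact ⟨q, Or.inr rfl, hq.1, h1⟩
        obtain ⟨j, hj⟩ := hendpt e heK he
        refine ⟨j, le_antisymm (hchild w j).2.2 ?_⟩
        rw [hbe]
        simp only [hb, wordMap_append_singleton]
        rcases hj with hj | hj <;> rw [hj]
        exacts [le_max_left _ _, le_max_right _ _]
      cover := fun x hx n => by
        have hcov : ∃ w : List A, w.length = n ∧ ∃ y ∈ K, wordMap ψ w y = x := by
          induction n with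
          | zero => exact ⟨[], rfl, x, hx, rfl⟩
          | succ n ih =>
            obtain ⟨w, hw, y, hy, rfl⟩ := ih
            rw [hK] at hy
            obtain ⟨j, z, hz, rfl⟩ := mem_iUnion.1 hy
            exact ⟨w ++ [j], by simp [hw], z, hz, wordMap_append_singleton w j z⟩
        obtain ⟨w, hw, y, hy, rfl⟩ := hcov
        exact ⟨w, hw, hmemIcc w y (hKH hy)⟩ }

end wordMap

/-! ### Hyperbolic `C²` systems -/

lemma exists_abs_sub_eq_derivWithin_mul {f : ℝ → ℝ} {I : Set ℝ} (hI : I.OrdConnected)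
    (hf : DifferentiableOn ℝ f I) {x y : ℝ} (hx : x ∈ I) (hy : y ∈ I) :
    ∃ ξ ∈ uIcc x y, |f x - f y| = |derivWithin f I ξ| * |x - y| := by
  have main : ∀ x ∈ I, ∀ y ∈ I, x < y →
      ∃ ξ ∈ Icc x y, |f x - f y| = |derivWithin f I ξ| * |x - y| := by
    intro x hx y hy hxy
    have hsub := hI.out hx hy
    obtain ⟨ξ, hξ, hd⟩ := exists_deriv_eq_slope f hxy (hf.continuousOn.mono hsub)
      (hf.mono (Ioo_subset_Icc_self.trans hsub))
    refine ⟨ξ, Ioo_subset_Icc_self hξ, ?_⟩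
    rw [derivWithin_of_mem_nhds (Filter.mem_of_superset (Icc_mem_nhds hξ.1 hξ.2) hsub), hd,
      abs_div, abs_sub_comm x y, div_mul_cancel₀ _ (abs_pos.2 (sub_pos.2 hxy).ne').ne',
      abs_sub_comm]
  rcases lt_trichotomy x y with hxy | rfl | hxy
  · rw [uIcc_of_le hxy.le]; exact main x hx y hy hxy
  · exact ⟨x, left_mem_uIcc, by simp⟩
  · rw [uIcc_of_ge hxy.le, abs_sub_comm (f x), abs_sub_comm x]; exact main y hy x hx hxy

/-- By the mean value theorem difference quotients are values of the derivative, which is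
`C`-Lipschitz on `[p, q]` and at least `σ` in absolute value; hence `κ = C / σ`. Larger constants
are allowed so that finitely many maps can share one. -/
lemma exists_isDistortionBounded {f : ℝ → ℝ} {I : Set ℝ} (hI : I.OrdConnected) {σ δ p q : ℝ}
    (hpq : p < q) (hsub : Icc p q ⊆ I) (hf : ContDiffOn ℝ 2 f I) (hσ : 0 < σ)
    (hbound : ∀ x ∈ I, σ ≤ |derivWithin f I x| ∧ |derivWithin f I x| ≤ δ)
    (hmaps : MapsTo f (Icc p q) (Icc p q)) :
    ∃ κ, 0 ≤ κ ∧ ∀ κ' ≥ κ, IsDistortionBounded f (Icc p q) σ δ κ' := by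
  have huniq : UniqueDiffOn ℝ I := uniqueDiffOn_convex hI.convex
    (hI.convex.nontrivial_iff_nonempty_interior.1
      ⟨p, hsub (left_mem_Icc.2 hpq.le), q, hsub (right_mem_Icc.2 hpq.le), hpq.ne⟩)
  have hdiff : DifferentiableOn ℝ f I := hf.differentiableOn (by norm_num)
  have hder : ContDiffOn ℝ 1 (derivWithin f I) I := hf.derivWithin huniq (by norm_num)
  obtain ⟨C, hC⟩ := (hder.mono hsub).exists_lipschitzOnWith one_ne_zero (convex_Icc p q)
    isCompact_Icc
  have hmv : ∀ x ∈ Icc p q, ∀ y ∈ Icc p q, ∃ ξ ∈ uIcc x y, ξ ∈ Icc p q ∧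
      |f x - f y| = |derivWithin f I ξ| * |x - y| := by
    intro x hx y hy
    obtain ⟨ξ, hξ, h⟩ := exists_abs_sub_eq_derivWithin_mul hI hdiff (hsub hx) (hsub hy)
    exact ⟨ξ, hξ, ordConnected_Icc.uIcc_subset hx hy hξ, h⟩
  have hlow : ∀ x ∈ Icc p q, ∀ y ∈ Icc p q, σ * |x - y| ≤ |f x - f y| := by
    intro x hx y hy
    obtain ⟨ξ, -, hξ, h⟩ := hmv x hx y hy
    rw [h]
    exact mul_le_mul_of_nonneg_right (hbound ξ (hsub hξ)).1 (abs_nonneg _)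
  refine ⟨C / σ, div_nonneg C.2 hσ.le, fun κ hκ => ⟨hmaps, ?_, hlow, ?_, ?_⟩⟩
  · refine (hdiff.continuousOn.mono hsub).strictMonoOn_of_injOn_Icc' hpq.le ?_
    intro x hx y hy hxy
    have h1 := hlow x hx y hy
    rw [hxy, sub_self, abs_zero] at h1
    have h2 := nonpos_of_mul_nonpos_right h1 hσ
    exact sub_eq_zero.1 (abs_nonpos_iff.1 h2)
  · intro x hx y hy
    obtain ⟨ξ, -, hξ, h⟩ := hmv x hx y hy
    rw [h]
    exact mul_le_mul_of_nonneg_right (hbound ξ (hsub hξ)).2 (abs_nonneg _)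
  · intro x hx y hy z hz v hv ℓ h1 h2 h3 h4
    obtain ⟨ξ, hξ, hξH, hξe⟩ := hmv x hx y hy
    obtain ⟨ζ, hζ, hζH, hζe⟩ := hmv z hz v hv
    have hdist : |ξ - ζ| ≤ ℓ := by
      rw [abs_le] at h1 h2 h3 h4 ⊢
      rcases mem_uIcc.1 hξ with ⟨_, _⟩ | ⟨_, _⟩ <;> rcases mem_uIcc.1 hζ with ⟨_, _⟩ | ⟨_, _⟩ <;>
        constructor <;> linarith
    have hlip := hC.dist_le_mul ξ hξH ζ hζH
    rw [Real.dist_eq, Real.dist_eq] at hlip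
    have hζσ := (hbound ζ (hsub hζH)).1
    have hℓ : 0 ≤ ℓ := (abs_nonneg _).trans hdist
    have hCκ : (C : ℝ) ≤ κ * σ := (div_le_iff₀ hσ).1 hκ
    have hκ0 : 0 ≤ κ := (div_nonneg C.2 hσ.le).trans hκ
    have hquot : |derivWithin f I ξ| ≤ (1 + κ * ℓ) * |derivWithin f I ζ| := by
      have i1 := abs_sub_abs_le_abs_sub (derivWithin f I ξ) (derivWithin f I ζ)
      have i2 : (C : ℝ) * |ξ - ζ| ≤ κ * σ * ℓ := by gcongr
      have i3 : κ * ℓ * σ ≤ κ * ℓ * |derivWithin f I ζ| := by gcongr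
      linarith
    rw [hξe, hζe]
    have := mul_le_mul_of_nonneg_right hquot (mul_nonneg (abs_nonneg (x - y)) (abs_nonneg (z - v)))
    linarith

namespace IsNonsingularHyperbolic

variable {M : ℕ} {ψ : Fin M → ℝ → ℝ} {I : Set ℝ}

lemma exists_isInvariantCompact (h : IsNonsingularHyperbolic ψ I) {δ : ℝ} (hδ1 : δ < 1)
    (hδ0 : 0 ≤ δ) (hcontr : ∀ i, ∀ x ∈ I, ∀ y ∈ I, |ψ i x - ψ i y| ≤ δ * |x - y|) :
    ∃ K, IsInvariantCompact (range ψ) I K := by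
  obtain ⟨i, -, x, hx, -⟩ := h.two_fixedPoints
  obtain ⟨c, hc⟩ := (finite_range fun i => |ψ i x - x|).bddAbove
  have hci : ∀ i, |ψ i x - x| ≤ c := fun i => hc (mem_range_self i)
  have hc0 : 0 ≤ c := (abs_nonneg _).trans (hci i)
  have h1δ : 0 < 1 - δ := by linarith
  -- The radius `R = c / (1 - δ)` solves `c + δ * R = R`, where `c` bounds the displacement of `x`
  -- by every map.
  refine SecondGenIFS.exists_isInvariantCompact (B := I ∩ Metric.closedBall x (c / (1 - δ)))
    ⟨ψ i, mem_range_self i⟩ ((isCompact_closedBall _ _).inter_left h.isClosed)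
    ⟨x, hx, Metric.mem_closedBall_self (by positivity)⟩ inter_subset_left ?_
  rintro _ ⟨j, rfl⟩ y ⟨hyI, hy⟩
  refine ⟨h.mapsTo j hyI, ?_⟩
  rw [Metric.mem_closedBall, Real.dist_eq] at hy ⊢
  have h1 := hcontr j y hyI x hx
  have h2 := abs_sub_le (ψ j y) (ψ j x) x
  have h3 := mul_le_mul_of_nonneg_left hy hδ0
  have h4 : c / (1 - δ) = c + δ * (c / (1 - δ)) := by
    field_simp
    ring
  linarith [hci j]

lemma exists_attractor_uniformDissection (h : IsNonsingularHyperbolic ψ I) :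
    ∃ K, IsAttractor (range ψ) I K ∧
      ∃ (a b : List (Fin M) → ℝ) (r : ℝ), UniformDissection a b r K := by
  obtain ⟨σ, δ, hσ, hδ1, hbound⟩ := h.deriv_bounds
  obtain ⟨i, j, x, hx, y, hy, hix, hjy, hxy⟩ := h.two_fixedPoints
  have hδ0 : 0 ≤ δ := hσ.le.trans ((hbound i x hx).1.trans (hbound i x hx).2)
  have hI := h.ordConnected
  have hcontr : ∀ i, ∀ x ∈ I, ∀ y ∈ I, |ψ i x - ψ i y| ≤ δ * |x - y| := by
    intro i x hx y hy
    obtain ⟨ξ, hξ, he⟩ := exists_abs_sub_eq_derivWithin_mul hI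
      ((h.contDiffOn i).differentiableOn (by norm_num)) hx hy
    rw [he]
    exact mul_le_mul_of_nonneg_right (hbound i ξ (hI.uIcc_subset hx hy hξ)).2 (abs_nonneg _)
  obtain ⟨K, hK⟩ := h.exists_isInvariantCompact hδ1 hδ0 hcontr
  refine ⟨K, hK.isAttractor hδ1 hδ0 (by rintro _ ⟨i, rfl⟩; exact hcontr i), ?_⟩
  have hψK : ∀ i, MapsTo (ψ i) K K := fun i z hz => hK.image_mem (mem_range_self i) hz
  -- Applying `ψ i` to a point of `K` nearest to the fixed point would bring it closer unless the
  -- distance is zero. Two distinct fixed points thus make the hull of `K` nondegenerate.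
  have hfix : ∀ i, ∀ x ∈ I, ψ i x = x → x ∈ K := by
    intro i x hx hix
    obtain ⟨z, hz, hxz⟩ := hK.isCompact.exists_infDist_eq_dist hK.nonempty x
    have h1 : dist x z ≤ dist x (ψ i z) := hxz ▸ Metric.infDist_le_dist_of_mem (hψK i hz)
    have h2 := hcontr i x hx z (hK.subset hz)
    rw [hix] at h2
    rw [Real.dist_eq, Real.dist_eq] at h1
    have h3 : |x - z| ≤ 0 := by nlinarith
    rwa [sub_eq_zero.1 (abs_nonpos_iff.1 h3)]
  obtain ⟨p, hp⟩ := hK.isCompact.exists_isLeast hK.nonempty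
  obtain ⟨q, hq⟩ := hK.isCompact.exists_isGreatest hK.nonempty
  have hxK := hfix i x hx hix
  have hyK := hfix j y hy hjy
  have hpq : p < q := by
    rcases lt_or_gt_of_ne hxy with hlt | hlt
    · exact (hp.2 hxK).trans_lt (hlt.trans_le (hq.2 hyK))
    · exact (hp.2 hyK).trans_lt (hlt.trans_le (hq.2 hxK))
  have hsub : Icc p q ⊆ I := hI.out (hK.subset hp.1) (hK.subset hq.1)
  have hKunion : K = ⋃ i, ψ i '' K := by
    have hcl : IsClosed (⋃ i, ψ i '' K) :=
      (isCompact_iUnion fun i =>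
        hK.isCompact.image_of_continuousOn ((h.contDiffOn i).continuousOn.mono hK.subset)).isClosed
    have := hK.fixed
    rw [hutchinson, biUnion_range, hcl.closure_eq] at this
    exact this.symm
  -- Each map is monotone on the hull and sends its endpoints into `K`.
  have hmaps : ∀ i, MapsTo (ψ i) (Icc p q) (Icc p q) := by
    intro i
    have hcont : ContinuousOn (ψ i) (Icc p q) := (h.contDiffOn i).continuousOn.mono hsub
    have hinj : InjOn (ψ i) (Icc p q) := by
      intro s hs t ht hst
      obtain ⟨ξ, hξ, he⟩ := exists_abs_sub_eq_derivWithin_mul hI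
        ((h.contDiffOn i).differentiableOn (by norm_num)) (hsub hs) (hsub ht)
      rw [hst, sub_self, abs_zero] at he
      rcases mul_eq_zero.1 he.symm with h0 | h0
      · linarith [(hbound i ξ (hI.uIcc_subset (hsub hs) (hsub ht) hξ)).1]
      · exact sub_eq_zero.1 (abs_eq_zero.1 h0)
    intro z hz
    have hz' := mem_Icc_min_max_of_strictMonoOn_or
      (hcont.strictMonoOn_of_injOn_Icc' hpq.le hinj) hz
    have h1 := hψK i hp.1
    have h2 := hψK i hq.1
    exact ⟨(le_min (hp.2 h1) (hp.2 h2)).trans hz'.1, hz'.2.trans (max_le (hq.2 h1) (hq.2 h2))⟩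
  choose κ hκ0 hκ using fun i => exists_isDistortionBounded hI hpq hsub (h.contDiffOn i) hσ
    (hbound i) (hmaps i)
  exact exists_uniformDissection_of_isDistortionBounded hpq hp hq hσ hδ0 hδ1
    (Finset.sum_nonneg fun i _ => hκ0 i) (fun i => hκ i (∑ i, κ i)
      (Finset.single_le_sum (fun i _ => hκ0 i) (Finset.mem_univ i))) hKunion

end IsNonsingularHyperbolic

end SecondGenIFS

theorem theorem1 :
    (∀ (M : ℕ) (ψ : Fin M → ℝ → ℝ) (I : Set ℝ),
      SecondGenIFS.IsNonsingularHyperbolic ψ I →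
      ∃ KΨ : Set ℝ, SecondGenIFS.IsAttractor (Set.range ψ) I KΨ ∧
        ∀ α : ℝ, 0 < α → α < 1 →
          ∃ KΦ : Set ℝ,
            SecondGenIFS.IsAttractor (SecondGenIFS.secondGeneration α KΨ) Set.univ KΦ ∧
            SecondGenIFS.IsFiniteUnionOfClosedIntervals KΦ) ∧
    (∀ K : Set ℝ, SecondGenIFS.IsCantorSet K → SecondGenIFS.AdmitsUlbd K →
      ∀ α : ℝ, 0 < α → α < 1 →
        ∃ KΦ : Set ℝ,
          SecondGenIFS.IsAttractor (SecondGenIFS.secondGeneration α K) Set.univ KΦ ∧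
          SecondGenIFS.IsFiniteUnionOfClosedIntervals KΦ) := by
  refine ⟨fun M ψ I h => ?_, ?_⟩
  · obtain ⟨K, hK, a, b, r, hu⟩ := h.exists_attractor_uniformDissection
    exact ⟨K, hK, fun α h0 h1 => hu.exists_attractor hK.1.isCompact h0 h1⟩
  · rintro K hK ⟨C, ⟨r, hr, hC⟩, rfl⟩ α h0 h1
    exact (C.uniformDissection hr hC).exists_attractor hK.isCompact h0 h1
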